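/- Let $n\ge 0$ be an integer and $a$ a real constant. On the open set $U=\{(q,p)\in\mathbb R^{2n}: q_i\ne q_j \text{ for } i\ne j\}$ consider the rational Calogero–Moser Hamiltonian (each pair of particles counted once) $$H=\frac12\sum_{i=1}^n p_i^2-a^2\sum_{1\le i<j\le n}\frac1{(q_i-q_j)^2},$$ the canonical Poisson bivector $P=\begin{pmatrix}0&I\\-I&0\end{pmatrix}$, the Lax matrix $\mathcal L$ with $\mathcal L_{ii}=p_i$ and $\mathcal L_{ij}=a/(q_i-q_j)$ for $i\neq j$, and the functions $H_k=\frac1{k!}\operatorname{trace}\mathcal L^k$ ($k\ge1$). Let $\{F,G\}=\langle dF,P\,dG\rangle$, $g_m=\frac12\{\sum_j q_j^2,H_m\}$ and $K_m=m\,g_1H_m-g_mH_1$ ($m\ge2$). Put $$\Pi_{ij}=p_ip_j,\qquad \Lambda_{ij}=-2q_i\sum_{k\ne j}\frac{a^2}{(q_j-q_k)^3},$$ and let $P'=P'_T+P'_\Lambda$ with $$P'_T=\begin{pmatrix}\sum_k\bigl(\frac{\partial\Pi_{jk}}{\partial p_i}-\frac{\partial\Pi_{ik}}{\partial p_j}\bigr)q_k&\Pi_{ij}\\-\Pi_{ji}&0\end{pmatrix},\qquad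 P'_\Lambda=\begin{pmatrix}0&\Lambda_{ij}\\-\Lambda_{ji}&\sum_k\bigl(\frac{\partial\Lambda_{ki}}{\partial q_j}-\frac{\partial\Lambda_{kj}}{\partial q_i}\bigr)p_k\end{pmatrix}.$$ Then: 1. $P'$ is a natural Poisson bivector on $U$: the Nijenhuis torsions of $\Pi$ (as a tensor field on $\mathbb R^n$ with coordinates $p$) and of $\Lambda$ (as a tensor field on the collision-free part of $\mathbb R^n$ with coordinates $q$) vanish, and $P'_T$, $P'_\Lambda$ and $P'$ are smooth Poisson bivectors on $U$. Moreover $P'$ is compatible with $P$: the Schouten brackets $[P,P]$, $[P',P']$ and $[P,P']$ vanish on $U$. 2. The recursion operator $N=P'P^{-1}$ satisfies $\operatorname{trace}N^k=2(2H)^k$ on $U$ for every $k\ge1$. 3. $H=H_2$ on $U$, and $P\,dH=\frac12P'\,d\ln H$ at every point of $U$ where $H\neq0$. 4. The functions $H_k$ are in bi-involution on $U$: $\langle dH_k,P\,dH_l\rangle=\langle dH_k,P'\,dH_l\rangle=0$ for all $k,l\ge1$. 5. For every $k\ge1$, $P\,dH=\frac1k\,P'\,d\ln H_k$ at every point of $U$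 where $H_k\ne0$; for every $m\ge2$, $P\,dH=\frac1{m-1}\,P'\,d\ln K_m$ at every point of $U$ where $K_m\ne0$. Here $\ln F$ means $\ln|F|$, so $d\ln F=dF/F$. -/

import Mathlib

open scoped ContDiff

noncomputable section

namespace CalogeroMoser

/-- Points `(q, p)` of `ℝ²ⁿ`: `x (Sum.inl i) = q_i` and `x (Sum.inr i) = p_i`. -/
abbrev Phase (n : ℕ) : Type := Fin n ⊕ Fin n → ℝ

/-- The position coordinates of a point of phase space. -/
def pos {n : ℕ} (x : Phase n) : Fin n → ℝ := fun i => x (Sum.inl i)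

/-- The momentum coordinates of a point of phase space. -/
def mom {n : ℕ} (x : Phase n) : Fin n → ℝ := fun i => x (Sum.inr i)

/-- The partial derivative `∂F/∂x_i` at `x`. -/
def partialDeriv {ι : Type*} [Fintype ι] [DecidableEq ι]
    (i : ι) (F : (ι → ℝ) → ℝ) (x : ι → ℝ) : ℝ :=
  fderiv ℝ F x (Pi.single i 1)

/-- The components `(∂F/∂x_i)_i` of the differential `dF` at `x`. -/
def differential {ι : Type*} [Fintype ι] [DecidableEq ι]
    (F : (ι → ℝ) → ℝ) (x : ι → ℝ) : ι → ℝ :=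
  fun i => partialDeriv i F x

/-- A bivector field, given by the matrix of its components in the coordinates `(q, p)`. -/
abbrev BivectorField (n : ℕ) : Type := Phase n → Matrix (Fin n ⊕ Fin n) (Fin n ⊕ Fin n) ℝ

/-- The components of the Schouten bracket `[P, Q]` of two bivector fields. -/
def schouten {n : ℕ} (P Q : BivectorField n) (x : Phase n) (i j k : Fin n ⊕ Fin n) : ℝ :=
  ∑ l,
    ((P x l i * partialDeriv l (fun y => Q y j k) x
        + Q x l i * partialDeriv l (fun y => P y j k) x)
      + (P x l j * partialDeriv l (fun y => Q y k i) x
        + Q x l j * partialDeriv l (fun y => P y k i) x)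
      + (P x l k * partialDeriv l (fun y => Q y i j) x
        + Q x l k * partialDeriv l (fun y => P y i j) x))

/-- `P` is a Poisson bivector on the open set `U`: a smooth antisymmetric tensor with
`[P, P] = 0`. -/
structure IsPoissonOn {n : ℕ} (U : Set (Phase n)) (P : BivectorField n) : Prop where
  smooth : ∀ i j, ContDiffOn ℝ ∞ (fun x => P x i j) U
  antisymm : ∀ x ∈ U, ∀ i j, P x i j = -P x j i
  schouten_self : ∀ x ∈ U, ∀ i j k, schouten P P x i j k = 0

/-- `P` and `Q` are compatible Poisson bivectors on `U`:
`[P, P] = 0`, `[Q, Q] = 0` and `[P, Q] = 0`. -/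
structure AreCompatibleOn {n : ℕ} (U : Set (Phase n)) (P Q : BivectorField n) : Prop where
  left : IsPoissonOn U P
  right : IsPoissonOn U Q
  schouten_eq_zero : ∀ x ∈ U, ∀ i j k, schouten P Q x i j k = 0

/-- The vector field `P dF`. -/
def hamVec {n : ℕ} (P : BivectorField n) (F : Phase n → ℝ) (x : Phase n) : Phase n :=
  (P x).mulVec (differential F x)

/-- The bracket `{F, G} = ⟨dF, P dG⟩` defined by a bivector field. -/
def bracket {n : ℕ} (P : BivectorField n) (F G : Phase n → ℝ) (x : Phase n) : ℝ :=
  differential F x ⬝ᵥ hamVec P G x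

/-- The canonical bivector on `ℝ²ⁿ`. -/
def canonical (n : ℕ) : BivectorField n := fun _ => Matrix.fromBlocks 0 1 (-1) 0

/-- The recursion operator `N = P' P⁻¹`, with `P` the canonical bivector. -/
def recursionOperator {n : ℕ} (P' : BivectorField n) : BivectorField n :=
  fun x => P' x * (canonical n x)⁻¹

/-- The geodesic part of a natural bivector, built from a matrix `Π(p)`. -/
def geodesicPart {n : ℕ} (S : (Fin n → ℝ) → Matrix (Fin n) (Fin n) ℝ) : BivectorField n :=
  fun x => Matrix.fromBlocks
    (Matrix.of fun i j => ∑ k,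
      (partialDeriv i (fun p => S p j k) (mom x)
        - partialDeriv j (fun p => S p i k) (mom x)) * pos x k)
    (S (mom x))
    (-(S (mom x)).transpose)
    0

/-- The potential part of a natural bivector, built from a matrix `Λ(q)`. -/
def potentialPart {n : ℕ} (L : (Fin n → ℝ) → Matrix (Fin n) (Fin n) ℝ) : BivectorField n :=
  fun x => Matrix.fromBlocks
    0
    (L (pos x))
    (-(L (pos x)).transpose)
    (Matrix.of fun i j => ∑ k,
      (partialDeriv j (fun q => L q k i) (pos x)
        - partialDeriv i (fun q => L q k j) (pos x)) * mom x k)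

/-- The bivector `P'` determined by the matrices `Π(p)` and `Λ(q)`. -/
def naturalBivector {n : ℕ} (S L : (Fin n → ℝ) → Matrix (Fin n) (Fin n) ℝ) : BivectorField n :=
  fun x => geodesicPart S x + potentialPart L x

/-- The component `T^k_{ij}` of the Nijenhuis torsion of the `(1,1)` tensor field `A` on `ℝⁿ`
with components `A^i_j = A i j`. -/
def nijenhuis {n : ℕ} (A : (Fin n → ℝ) → Matrix (Fin n) (Fin n) ℝ) (y : Fin n → ℝ)
    (i j k : Fin n) : ℝ :=
  ∑ l,
    (A y l i * partialDeriv l (fun z => A z k j) y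
      - A y l j * partialDeriv l (fun z => A z k i) y
      - A y k l * partialDeriv i (fun z => A z l j) y
      + A y k l * partialDeriv j (fun z => A z l i) y)

/-- The points of phase space whose positions lie in `W`. -/
def phaseOver {n : ℕ} (W : Set (Fin n → ℝ)) : Set (Phase n) := {x | pos x ∈ W}

/-- The pair `(Π, Λ)` defines a natural Poisson bivector over the open set `W` of positions:
`Π` (as a tensor field in the momenta) and `Λ` (as a tensor field in the positions) are torsionless,
and the geodesic part, the potential part and their sum are Poisson. -/
structure IsNaturalPoissonOn {n : ℕ} (W : Set (Fin n → ℝ))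
    (S L : (Fin n → ℝ) → Matrix (Fin n) (Fin n) ℝ) : Prop where
  torsion_geodesic : ∀ p i j k, nijenhuis S p i j k = 0
  torsion_potential : ∀ q ∈ W, ∀ i j k, nijenhuis L q i j k = 0
  poisson_geodesic : IsPoissonOn (phaseOver W) (geodesicPart S)
  poisson_potential : IsPoissonOn (phaseOver W) (potentialPart L)
  poisson : IsPoissonOn (phaseOver W) (naturalBivector S L)

/-- The collision-free configurations. -/
def collisionFree (n : ℕ) : Set (Fin n → ℝ) := {q | ∀ i j, i ≠ j → q i ≠ q j}

/-- The collision-free part of phase space. -/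
def domain (n : ℕ) : Set (Phase n) := phaseOver (collisionFree n)

/-- The rational Calogero–Moser Hamiltonian
`H = ½ ∑ p_i² - a² ∑_{i<j} (q_i - q_j)⁻²`; each pair of particles is counted once. -/
def hamiltonian {n : ℕ} (a : ℝ) (x : Phase n) : ℝ :=
  (1 / 2) * ∑ i, mom x i ^ 2
    - a ^ 2 * ∑ i, ∑ j, if i < j then 1 / (pos x i - pos x j) ^ 2 else 0

/-- `Π_ij = p_i p_j`. -/
def geodesicMatrix {n : ℕ} (p : Fin n → ℝ) : Matrix (Fin n) (Fin n) ℝ :=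
  Matrix.of fun i j => p i * p j

/-- `Λ_ij = -2 a² q_i ∑_{k ≠ j} (q_j - q_k)⁻³`. -/
def potentialMatrix {n : ℕ} (a : ℝ) (q : Fin n → ℝ) : Matrix (Fin n) (Fin n) ℝ :=
  Matrix.of fun i j => -2 * q i * ∑ k ∈ Finset.univ.erase j, a ^ 2 / (q j - q k) ^ 3

/-- The Calogero–Moser natural bivector `P'`. -/
def secondBivector (n : ℕ) (a : ℝ) : BivectorField n :=
  naturalBivector geodesicMatrix (potentialMatrix a)

/-- The Lax matrix. -/
def lax {n : ℕ} (a : ℝ) (x : Phase n) : Matrix (Fin n) (Fin n) ℝ :=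
  Matrix.of fun i j => if i = j then mom x i else a / (pos x i - pos x j)

/-- The Lax integrals `H_k = trace 𝓛ᵏ / k!`. -/
def laxIntegral {n : ℕ} (a : ℝ) (k : ℕ) (x : Phase n) : ℝ :=
  (lax a x ^ k).trace / (k.factorial : ℝ)

/-- `g_m = ½ {∑ q_j², H_m}` (canonical bracket). -/
def auxG {n : ℕ} (a : ℝ) (m : ℕ) (x : Phase n) : ℝ :=
  (1 / 2) * bracket (canonical n) (fun y => ∑ j, pos y j ^ 2) (laxIntegral a m) x

/-- The additional integrals `K_m = m g_1 H_m - g_m H_1`. -/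
def extraIntegral {n : ℕ} (a : ℝ) (m : ℕ) (x : Phase n) : ℝ :=
  (m : ℝ) * auxG a 1 x * laxIntegral a m x - auxG a m x * laxIntegral a 1 x

end CalogeroMoser

end

/-!
Let `D = (q, -p)` be the generator of the symplectic dilations `(q, p) ↦ (λ q, λ⁻¹ p)` and
`X = P dH`. The proof rests on the identity `P' = D ∧ X` (`secondBivector_eq_wedge`); the
geodesic and the potential parts of `P'` are likewise the wedge products of `D` with the kinetic
and the potential parts of `X`. The Hamiltonian has weight `-2` under the dilations, so
`[D, X] = -2 X`, and the same holds for both parts of `X`.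

* Since `[D, Y]` is a multiple of `Y`, the bracket `[D ∧ Y, D ∧ Y]`, a multiple of
  `D ∧ Y ∧ [D, Y]`, vanishes (`schouten_wedge_self`). Since `D` and `X` are Hamiltonian fields, they
  preserve `P`, hence `[P, D ∧ X] = 0` (`schouten_const_wedge`).
* The recursion operator has rank at most two and satisfies `N² = 2 H N`, `trace N = 4 H`
  (`recursionOperator_sq`), which gives the traces of its powers.
* For every function `F`, `P' dF = (X F) D - (D F) X` (`hamVec_secondBivector`). A first integral
  `F` of `X` which has weight `-c` therefore satisfies `P' dF = c F P dH`
  (`hamVec_canonical_eq_of_weight`), and any two first integrals of `X` are in involution for `P'`.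

It remains to see that `H_k` and `K_m` are first integrals of weights `-k` and `-(m - 1)`, and that
the `H_k` commute for `P`. Let `Q = diag (q)`. For a matrix `B` commuting with `𝓛`, such as
`B = 𝓛ᵏ`, there is a matrix `M`, with vanishing row sums and `[Q, M] = diag B - B`, such that the
flow attached to `B` satisfies `𝓛' = [𝓛, M]` (`laxDeriv_laxFlow`) and `Q' = [Q, M] + B`
(`diagonal_pos_laxFlow`). The first equation is obtained from the moment map equation
`[Q, 𝓛] = a (E - 1)`, where all entries of `E` are `1`, and it implies that every
`trace 𝓛ˡ` is constant along the Hamiltonian flow of every `trace 𝓛ᵏ⁺¹`. Both equations for `B = 𝓛`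
and `g_m = trace (Q 𝓛ᵐ⁻¹) / (m - 1)!` give `X g_m = m H_m` (`fderiv_auxG_scaledFlow`), whence
`X K_m = 0`.
-/

namespace CalogeroMoser

/-! ### Directional derivatives -/

theorem differential_dotProduct {ι : Type*} [Fintype ι] [DecidableEq ι]
    (F : (ι → ℝ) → ℝ) (x v : ι → ℝ) : differential F x ⬝ᵥ v = fderiv ℝ F x v := by
  conv_rhs => rw [← Finset.univ_sum_single v, map_sum]
  refine Finset.sum_congr rfl fun i _ => ?_
  have h : (Pi.single i (v i) : ι → ℝ) = v i • Pi.single i 1 := by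
    rw [← Pi.single_smul, smul_eq_mul, mul_one]
  rw [h, map_smul, smul_eq_mul, mul_comm]
  rfl

theorem sum_mul_partialDeriv {ι : Type*} [Fintype ι] [DecidableEq ι]
    (F : (ι → ℝ) → ℝ) (x v : ι → ℝ) : ∑ l, v l * partialDeriv l F x = fderiv ℝ F x v := by
  rw [← differential_dotProduct, dotProduct_comm]
  rfl

theorem fderiv_eq_of_hasLineDerivAt {E : Type*} [NormedAddCommGroup E] [NormedSpace ℝ E]
    {F : E → ℝ} {x v : E} {c : ℝ} (hF : DifferentiableAt ℝ F x)
    (h : HasLineDerivAt ℝ F c x v) : fderiv ℝ F x v = c :=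
  (hF.hasFDerivAt.hasLineDerivAt v).unique h

theorem hasLineDerivAt_apply {ι : Type*} [Fintype ι] (i : ι) (x v : ι → ℝ) :
    HasLineDerivAt ℝ (fun y : ι → ℝ => y i) (v i) x v := by
  have h : HasDerivAt (fun t : ℝ => x i + t * v i) (v i) 0 := by
    simpa using ((hasDerivAt_id (0 : ℝ)).mul_const (v i)).const_add (x i)
  exact h

theorem partialDeriv_mul {ι : Type*} [Fintype ι] [DecidableEq ι] {F G : (ι → ℝ) → ℝ} {x : ι → ℝ}
    (hF : DifferentiableAt ℝ F x) (hG : DifferentiableAt ℝ G x) (i : ι) :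
    partialDeriv i (fun y => F y * G y) x
      = F x * partialDeriv i G x + G x * partialDeriv i F x := by
  simp [partialDeriv, fderiv_fun_mul hF hG]

theorem partialDeriv_apply {ι : Type*} [Fintype ι] [DecidableEq ι] (i j : ι) (x : ι → ℝ) :
    partialDeriv i (fun y => y j) x = if i = j then 1 else 0 := by
  have h := fderiv_eq_of_hasLineDerivAt (by fun_prop) (hasLineDerivAt_apply j x (Pi.single i 1))
  rw [partialDeriv, h, Pi.single_apply]
  simp only [eq_comm]

/-! ### Decomposable bivectors -/

/-- The decomposable bivector field `A ∧ B`, with components `A_i B_j - B_i A_j`. -/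
def wedge {n : ℕ} (A B : Phase n → Phase n) : BivectorField n :=
  fun x => Matrix.of fun i j => A x i * B x j - B x i * A x j

theorem wedge_mulVec {n : ℕ} (A B : Phase n → Phase n) (x w : Phase n) :
    (wedge A B x).mulVec w = (w ⬝ᵥ B x) • A x - (w ⬝ᵥ A x) • B x := by
  funext i
  simp only [wedge, Matrix.mulVec, dotProduct, Matrix.of_apply, Pi.sub_apply, Pi.smul_apply,
    smul_eq_mul, Finset.sum_mul, ← Finset.sum_sub_distrib]
  exact Finset.sum_congr rfl fun j _ => by ring

theorem schouten_congr {n : ℕ} {P P' Q Q' : BivectorField n} {x : Phase n}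
    (hP : P =ᶠ[nhds x] P') (hQ : Q =ᶠ[nhds x] Q') (i j k : Fin n ⊕ Fin n) :
    schouten P Q x i j k = schouten P' Q' x i j k := by
  have h : ∀ {R R' : BivectorField n}, R =ᶠ[nhds x] R' → ∀ l i j,
      partialDeriv l (fun y => R y i j) x = partialDeriv l (fun y => R' y i j) x := by
    intro R R' hR l i j
    have hij : (fun y => R y i j) =ᶠ[nhds x] fun y => R' y i j := by
      filter_upwards [hR] with y hy
      rw [hy]
    rw [partialDeriv, partialDeriv, hij.fderiv_eq]
  unfold schouten
  simp only [hP.self_of_nhds, hQ.self_of_nhds, h hP, h hQ]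

theorem fderiv_wedge {n : ℕ} {A B : Phase n → Phase n} {x : Phase n}
    (hA : ∀ i, DifferentiableAt ℝ (fun y => A y i) x)
    (hB : ∀ i, DifferentiableAt ℝ (fun y => B y i) x) (v : Phase n) (i j : Fin n ⊕ Fin n) :
    fderiv ℝ (fun y => wedge A B y i j) x v
      = A x i * fderiv ℝ (fun y => B y j) x v + B x j * fderiv ℝ (fun y => A y i) x v
        - (B x i * fderiv ℝ (fun y => A y j) x v + A x j * fderiv ℝ (fun y => B y i) x v) := by
  simp only [wedge, Matrix.of_apply]
  rw [fderiv_fun_sub ((hA i).fun_mul (hB j)) ((hB i).fun_mul (hA j)), fderiv_fun_mul (hA i) (hB j),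
    fderiv_fun_mul (hB i) (hA j)]
  simp

/-- The hypothesis says that the Lie bracket `[A, B]` is `c B`, so
`[A ∧ B, A ∧ B]`, a multiple of `A ∧ B ∧ [A, B]`, vanishes. -/
theorem schouten_wedge_self {n : ℕ} {A B : Phase n → Phase n} {x : Phase n} {c : ℝ}
    (hA : ∀ i, DifferentiableAt ℝ (fun y => A y i) x)
    (hB : ∀ i, DifferentiableAt ℝ (fun y => B y i) x)
    (hAB : ∀ i, fderiv ℝ (fun y => B y i) x (A x)
      = fderiv ℝ (fun y => A y i) x (B x) + c * B x i)
    (i j k : Fin n ⊕ Fin n) : schouten (wedge A B) (wedge A B) x i j k = 0 := by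
  have key : ∀ i j k, ∑ l, wedge A B x l i * partialDeriv l (fun y => wedge A B y j k) x
      = B x i * fderiv ℝ (fun y => wedge A B y j k) x (A x)
        - A x i * fderiv ℝ (fun y => wedge A B y j k) x (B x) := by
    intro i j k
    rw [← sum_mul_partialDeriv, ← sum_mul_partialDeriv, Finset.mul_sum, Finset.mul_sum,
      ← Finset.sum_sub_distrib]
    refine Finset.sum_congr rfl fun l _ => ?_
    simp only [wedge, Matrix.of_apply]
    ring
  unfold schouten
  simp only [Finset.sum_add_distrib, key, fderiv_wedge hA hB, hAB]
  ring

/-- The hypotheses say that the Lie derivatives of the constant bivector `P` along `A` and `B`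
vanish. -/
theorem schouten_const_wedge {n : ℕ} {A B : Phase n → Phase n} {x : Phase n}
    {P : Matrix (Fin n ⊕ Fin n) (Fin n ⊕ Fin n) ℝ}
    (hA : ∀ i, DifferentiableAt ℝ (fun y => A y i) x)
    (hB : ∀ i, DifferentiableAt ℝ (fun y => B y i) x)
    (hPA : ∀ i j, fderiv ℝ (fun y => A y j) x (fun l => P l i)
      = fderiv ℝ (fun y => A y i) x (fun l => P l j))
    (hPB : ∀ i j, fderiv ℝ (fun y => B y j) x (fun l => P l i)
      = fderiv ℝ (fun y => B y i) x (fun l => P l j))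
    (i j k : Fin n ⊕ Fin n) : schouten (fun _ => P) (wedge A B) x i j k = 0 := by
  have h0 : ∀ l j k, partialDeriv l (fun _ : Phase n => P j k) x = 0 := by
    intro l j k
    simp [partialDeriv]
  have key : ∀ i j k, ∑ l, P l i * partialDeriv l (fun y => wedge A B y j k) x
      = fderiv ℝ (fun y => wedge A B y j k) x (fun l => P l i) :=
    fun i j k => sum_mul_partialDeriv _ _ _
  unfold schouten
  simp only [h0, mul_zero, add_zero, Finset.sum_add_distrib, key, fderiv_wedge hA hB]
  rw [hPA j i, hPA k i, hPA k j, hPB j i, hPB k i, hPB k j]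
  ring

theorem isPoissonOn_of_eq_wedge {n : ℕ} {U : Set (Phase n)} (hU : IsOpen U)
    {P : BivectorField n} {A B : Phase n → Phase n} {c : ℝ}
    (hP : ∀ x ∈ U, P x = wedge A B x)
    (hA : ∀ i, ContDiffOn ℝ ∞ (fun y => A y i) U)
    (hB : ∀ i, ContDiffOn ℝ ∞ (fun y => B y i) U)
    (hAB : ∀ x ∈ U, ∀ i, fderiv ℝ (fun y => B y i) x (A x)
      = fderiv ℝ (fun y => A y i) x (B x) + c * B x i) :
    IsPoissonOn U P where
  smooth i j := by
    refine ContDiffOn.congr (((hA i).mul (hB j)).sub ((hB i).mul (hA j))) fun x hx => ?_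
    rw [hP x hx]
    rfl
  antisymm x hx i j := by
    rw [hP x hx]
    simp only [wedge, Matrix.of_apply]
    ring
  schouten_self x hx i j k := by
    have hd : ∀ {F : Phase n → ℝ}, ContDiffOn ℝ ∞ F U → DifferentiableAt ℝ F x := fun h =>
      (h.contDiffAt (hU.mem_nhds hx)).differentiableAt (by simp)
    have he : P =ᶠ[nhds x] wedge A B := by
      filter_upwards [hU.mem_nhds hx] with y hy using hP y hy
    rw [schouten_congr he he]
    exact schouten_wedge_self (fun i => hd (hA i)) (fun i => hd (hB i)) (hAB x hx) i j k

/-! ### The collision-free domain and the forces -/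

theorem isOpen_collisionFree (n : ℕ) : IsOpen (collisionFree n) := by
  have h : collisionFree n = ⋂ i, ⋂ j, ⋂ _ : i ≠ j, {q : Fin n → ℝ | q i ≠ q j} := by
    ext q
    simp [collisionFree]
  rw [h]
  refine isOpen_iInter_of_finite fun i => isOpen_iInter_of_finite fun j =>
    isOpen_iInter_of_finite fun _ => ?_
  exact isOpen_ne_fun (continuous_apply i) (continuous_apply j)

theorem contDiff_pos (n : ℕ) : ContDiff ℝ ∞ (pos : Phase n → Fin n → ℝ) := by
  unfold pos
  fun_prop

theorem isOpen_domain (n : ℕ) : IsOpen (domain n) :=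
  (isOpen_collisionFree n).preimage (contDiff_pos n).continuous

/-- The force `-∂U/∂q_j`, where `U` is the potential energy of the Calogero–Moser Hamiltonian. The
summand `k = j` is `a² / 0 = 0`. -/
noncomputable def force {n : ℕ} (a : ℝ) (q : Fin n → ℝ) (j : Fin n) : ℝ :=
  -2 * ∑ k, a ^ 2 / (q j - q k) ^ 3

/-- The derivative of the force in the direction `v`. The summand `k = j` vanishes. -/
noncomputable def forceDeriv {n : ℕ} (a : ℝ) (q v : Fin n → ℝ) (j : Fin n) : ℝ :=
  ∑ k, 6 * a ^ 2 * (v j - v k) / (q j - q k) ^ 4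

theorem potentialMatrix_apply {n : ℕ} (a : ℝ) (q : Fin n → ℝ) (i j : Fin n) :
    potentialMatrix a q i j = q i * force a q j := by
  rw [potentialMatrix, Matrix.of_apply, force, Finset.sum_erase _ (by simp)]
  ring

theorem contDiffOn_force {n : ℕ} (a : ℝ) (j : Fin n) :
    ContDiffOn ℝ ∞ (fun q => force a q j) (collisionFree n) := by
  unfold force
  refine contDiffOn_const.mul (ContDiffOn.sum fun k _ => ?_)
  by_cases h : j = k
  · subst h
    simpa using contDiffOn_const
  · refine contDiffOn_const.div (ContDiff.contDiffOn (by fun_prop)) fun q hq => ?_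
    exact pow_ne_zero _ (sub_ne_zero.2 (hq j k h))

theorem differentiableAt_force {n : ℕ} (a : ℝ) {q : Fin n → ℝ} (hq : q ∈ collisionFree n)
    (j : Fin n) : DifferentiableAt ℝ (fun q => force a q j) q :=
  ((contDiffOn_force a j).contDiffAt ((isOpen_collisionFree n).mem_nhds hq)).differentiableAt
    (by simp)

theorem hasLineDerivAt_force {n : ℕ} (a : ℝ) {q : Fin n → ℝ} (hq : q ∈ collisionFree n)
    (v : Fin n → ℝ) (j : Fin n) :
    HasLineDerivAt ℝ (fun q => force a q j) (forceDeriv a q v j) q v := by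
  have h : ∀ k ∈ Finset.univ,
      HasDerivAt (fun t : ℝ => a ^ 2 / ((q j + t * v j) - (q k + t * v k)) ^ 3)
        (-3 * a ^ 2 * (v j - v k) / (q j - q k) ^ 4) 0 := by
    intro k _
    by_cases hjk : j = k
    · subst hjk
      simpa using hasDerivAt_const (0 : ℝ) (0 : ℝ)
    have hne : q j - q k ≠ 0 := sub_ne_zero.2 (hq j k hjk)
    have h1 : HasDerivAt (fun t : ℝ => (q j + t * v j) - (q k + t * v k)) (v j - v k) 0 := by
      simpa using (((hasDerivAt_id (0 : ℝ)).mul_const (v j)).const_add (q j)).fun_sub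
        (((hasDerivAt_id (0 : ℝ)).mul_const (v k)).const_add (q k))
    have h2 := (hasDerivAt_const (0 : ℝ) (a ^ 2)).fun_div (h1.fun_pow 3) (by simpa using hne)
    refine h2.congr_deriv ?_
    simp only [zero_mul, add_zero]
    field_simp
    push_cast
    ring
  have h3 := (HasDerivAt.fun_sum h).const_mul (-2)
  have h4 : -2 * ∑ k, -3 * a ^ 2 * (v j - v k) / (q j - q k) ^ 4 = forceDeriv a q v j := by
    rw [forceDeriv, Finset.mul_sum]
    exact Finset.sum_congr rfl fun k _ => by ring
  rw [h4] at h3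
  exact h3

theorem fderiv_force {n : ℕ} (a : ℝ) {q : Fin n → ℝ} (hq : q ∈ collisionFree n)
    (v : Fin n → ℝ) (j : Fin n) :
    fderiv ℝ (fun q => force a q j) q v = forceDeriv a q v j :=
  fderiv_eq_of_hasLineDerivAt (differentiableAt_force a hq j) (hasLineDerivAt_force a hq v j)

/-- The force is homogeneous of degree `-3`. -/
theorem forceDeriv_self {n : ℕ} (a : ℝ) {q : Fin n → ℝ} (hq : q ∈ collisionFree n) (j : Fin n) :
    forceDeriv a q q j = -3 * force a q j := by
  rw [forceDeriv, force, Finset.mul_sum, Finset.mul_sum]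
  refine Finset.sum_congr rfl fun k _ => ?_
  by_cases hjk : j = k
  · simp [hjk]
  have hne : q j - q k ≠ 0 := sub_ne_zero.2 (hq j k hjk)
  field_simp
  ring

/-- The Hessian of the potential energy is symmetric. -/
theorem forceDeriv_single_comm {n : ℕ} (a : ℝ) (q : Fin n → ℝ) (i j : Fin n) :
    forceDeriv a q (Pi.single i 1) j = forceDeriv a q (Pi.single j 1) i := by
  by_cases hij : i = j
  · rw [hij]
  have h : ∀ i j : Fin n, i ≠ j →
      forceDeriv a q (Pi.single i 1) j = -(6 * a ^ 2) / (q j - q i) ^ 4 := by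
    intro i j hij
    rw [forceDeriv, Finset.sum_eq_single i]
    · simp [hij.symm]
    · intro k _ hk
      simp [hij.symm, hk]
    · simp
  rw [h i j hij, h j i (Ne.symm hij), ← neg_sub (q i) (q j), Even.neg_pow (by decide)]

theorem partialDeriv_force_comm {n : ℕ} (a : ℝ) {q : Fin n → ℝ} (hq : q ∈ collisionFree n)
    (i j : Fin n) : partialDeriv i (fun q => force a q j) q
      = partialDeriv j (fun q => force a q i) q := by
  rw [partialDeriv, partialDeriv, fderiv_force a hq, fderiv_force a hq, forceDeriv_single_comm]

/-! ### The torsions of `Π` and `Λ` -/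

theorem partialDeriv_geodesicMatrix {n : ℕ} (p : Fin n → ℝ) (l i j : Fin n) :
    partialDeriv l (fun z : Fin n → ℝ => geodesicMatrix z i j) p
      = p i * (if l = j then 1 else 0) + p j * (if l = i then 1 else 0) := by
  simp only [geodesicMatrix, Matrix.of_apply]
  rw [partialDeriv_mul (by fun_prop) (by fun_prop), partialDeriv_apply, partialDeriv_apply]

theorem nijenhuis_geodesicMatrix {n : ℕ} (p : Fin n → ℝ) (i j k : Fin n) :
    nijenhuis geodesicMatrix p i j k = 0 := by
  unfold nijenhuis
  simp only [partialDeriv_geodesicMatrix]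
  simp only [geodesicMatrix, Matrix.of_apply]
  simp only [mul_add, Finset.sum_add_distrib, Finset.sum_sub_distrib, mul_ite, mul_one, mul_zero,
    Finset.sum_ite_eq', Finset.sum_ite_eq, Finset.mem_univ, if_true]
  by_cases hij : i = j
  · subst hij
    simp
  · simp [hij, Ne.symm hij]
    ring

theorem partialDeriv_potentialMatrix {n : ℕ} (a : ℝ) {q : Fin n → ℝ}
    (hq : q ∈ collisionFree n) (l i j : Fin n) :
    partialDeriv l (fun z => potentialMatrix a z i j) q
      = q i * partialDeriv l (fun z => force a z j) q
        + force a q j * (if l = i then 1 else 0) := by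
  simp only [potentialMatrix_apply]
  rw [partialDeriv_mul (by fun_prop) (differentiableAt_force a hq j), partialDeriv_apply]

theorem nijenhuis_potentialMatrix {n : ℕ} (a : ℝ) {q : Fin n → ℝ} (hq : q ∈ collisionFree n)
    (i j k : Fin n) : nijenhuis (potentialMatrix a) q i j k = 0 := by
  have hE : ∀ j, ∑ l, q l * partialDeriv l (fun z => force a z j) q = -3 * force a q j := by
    intro j
    rw [sum_mul_partialDeriv, fderiv_force a hq, forceDeriv_self a hq]
  have h : nijenhuis (potentialMatrix a) q i j k
      = q k * force a q i * ∑ l, q l * partialDeriv l (fun z => force a z j) q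
        - q k * force a q j * ∑ l, q l * partialDeriv l (fun z => force a z i) q := by
    -- the terms in which `∂_i` or `∂_j` hits the factor `q_l` of `Λ`; their total is zero
    have hs : ∑ l, (q k * force a q l * force a q i * (if j = l then (1 : ℝ) else 0)
        - q k * force a q l * force a q j * (if i = l then (1 : ℝ) else 0)) = 0 := by
      simp only [Finset.sum_sub_distrib, mul_ite, mul_one, mul_zero, Finset.sum_ite_eq,
        Finset.mem_univ, if_true]
      ring
    rw [← add_zero (_ - _), ← hs, Finset.mul_sum, Finset.mul_sum, ← Finset.sum_sub_distrib,
      ← Finset.sum_add_distrib]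
    unfold nijenhuis
    refine Finset.sum_congr rfl fun l _ => ?_
    simp only [partialDeriv_potentialMatrix a hq, partialDeriv_force_comm a hq j i]
    simp only [potentialMatrix_apply]
    ring
  rw [h, hE, hE]
  ring

/-! ### The bivectors as wedge products -/

/-- The generator `(q, -p)` of the symplectic dilations `(q, p) ↦ (λ q, λ⁻¹ p)`. -/
def dilation {n : ℕ} (x : Phase n) : Phase n := Sum.elim (pos x) (-mom x)

/-- The field `(s p, t f)`, where `f` are the Calogero–Moser forces. The
Hamiltonian field `P dH` is the case `s = t = 1`; the cases `(s, t) = (1, 0)` and `(0, 1)` are its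
kinetic and potential parts. -/
noncomputable def scaledFlow {n : ℕ} (s t a : ℝ) (x : Phase n) : Phase n :=
  Sum.elim (s • mom x) (t • force a (pos x))

theorem contDiff_dilation {n : ℕ} (i : Fin n ⊕ Fin n) :
    ContDiff ℝ ∞ (fun y : Phase n => dilation y i) := by
  cases i <;> simp only [dilation, pos, mom, Sum.elim_inl, Sum.elim_inr, Pi.neg_apply] <;> fun_prop

theorem fderiv_dilation {n : ℕ} (x v : Phase n) (i : Fin n ⊕ Fin n) :
    fderiv ℝ (fun y : Phase n => dilation y i) x v = dilation v i := by
  refine fderiv_eq_of_hasLineDerivAt ((contDiff_dilation i).differentiable (by simp) x) ?_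
  cases i with
  | inl i => exact hasLineDerivAt_apply (Sum.inl i) x v
  | inr i =>
    have h := (show HasDerivAt _ _ _ from hasLineDerivAt_apply (Sum.inr i) x v).fun_neg
    exact h

theorem contDiffOn_force_pos {n : ℕ} (a : ℝ) (j : Fin n) :
    ContDiffOn ℝ ∞ (fun x : Phase n => force a (pos x) j) (domain n) :=
  (contDiffOn_force a j).comp (contDiff_pos n).contDiffOn fun _ hx => hx

theorem contDiffOn_scaledFlow {n : ℕ} (s t a : ℝ) (i : Fin n ⊕ Fin n) :
    ContDiffOn ℝ ∞ (fun y : Phase n => scaledFlow s t a y i) (domain n) := by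
  cases i with
  | inl i =>
    simp only [scaledFlow, mom, Sum.elim_inl, Pi.smul_apply]
    fun_prop
  | inr i => exact (contDiffOn_force_pos a i).const_smul t

theorem differentiableAt_of_contDiffOn_domain {n : ℕ} {F : Phase n → ℝ} {x : Phase n}
    (hF : ContDiffOn ℝ ∞ F (domain n)) (hx : x ∈ domain n) : DifferentiableAt ℝ F x :=
  (hF.contDiffAt ((isOpen_domain n).mem_nhds hx)).differentiableAt (by simp)

theorem fderiv_scaledFlow {n : ℕ} (s t a : ℝ) {x : Phase n} (hx : x ∈ domain n) (v : Phase n)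
    (i : Fin n ⊕ Fin n) :
    fderiv ℝ (fun y : Phase n => scaledFlow s t a y i) x v
      = Sum.elim (s • mom v) (t • forceDeriv a (pos x) (pos v)) i := by
  refine fderiv_eq_of_hasLineDerivAt
    (differentiableAt_of_contDiffOn_domain (contDiffOn_scaledFlow s t a i) hx) ?_
  cases i with
  | inl i =>
    exact (show HasDerivAt _ _ _ from hasLineDerivAt_apply (Sum.inr i) x v).const_mul s
  | inr i =>
    exact (show HasDerivAt _ _ _ from hasLineDerivAt_force a hx (pos v) i).const_mul t

theorem forceDeriv_zero {n : ℕ} (a : ℝ) (q : Fin n → ℝ) (j : Fin n) :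
    forceDeriv a q 0 j = 0 := by
  simp [forceDeriv]

/-- The bracket relation `[D, Y] = -2 Y` between the dilation field `D` and each field
`Y = scaledFlow s t a`. -/
theorem lie_dilation_scaledFlow {n : ℕ} (s t a : ℝ) {x : Phase n} (hx : x ∈ domain n)
    (i : Fin n ⊕ Fin n) :
    fderiv ℝ (fun y => scaledFlow s t a y i) x (dilation x)
      = fderiv ℝ (fun y => dilation y i) x (scaledFlow s t a x)
        + (-2) * scaledFlow s t a x i := by
  rw [fderiv_scaledFlow s t a hx, fderiv_dilation]
  cases i with
  | inl i =>
    simp only [scaledFlow, dilation, Sum.elim_inl, Pi.smul_apply, smul_eq_mul, mom, pos,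
      Sum.elim_inr, Pi.neg_apply]
    ring
  | inr i =>
    have h : pos (dilation x) = pos x := rfl
    have h' : mom (scaledFlow s t a x) = t • force a (pos x) := rfl
    simp only [dilation, Sum.elim_inr, Pi.smul_apply, smul_eq_mul, Pi.neg_apply, h']
    rw [← dilation, h, forceDeriv_self a hx]
    simp only [scaledFlow, Sum.elim_inr, Pi.smul_apply, smul_eq_mul]
    ring

theorem isPoissonOn_wedge_scaledFlow {n : ℕ} (s t a : ℝ) {P : BivectorField n}
    (hP : ∀ x ∈ domain n, P x = wedge dilation (scaledFlow s t a) x) :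
    IsPoissonOn (domain n) P :=
  isPoissonOn_of_eq_wedge (isOpen_domain n) hP (fun i => (contDiff_dilation i).contDiffOn)
    (contDiffOn_scaledFlow s t a) fun _ hx => lie_dilation_scaledFlow s t a hx

theorem geodesicPart_eq_wedge {n : ℕ} (a : ℝ) (x : Phase n) :
    geodesicPart geodesicMatrix x = wedge dilation (scaledFlow 1 0 a) x := by
  ext i j
  cases i <;> cases j
  · rename_i i j
    simp only [geodesicPart, Matrix.fromBlocks_apply₁₁, Matrix.of_apply,
      partialDeriv_geodesicMatrix, wedge, dilation, scaledFlow, Sum.elim_inl, Pi.smul_apply,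
      smul_eq_mul]
    simp only [add_mul, sub_mul, mul_assoc, ite_mul, one_mul, zero_mul, mul_ite, mul_zero,
      Finset.sum_add_distrib, Finset.sum_sub_distrib, Finset.sum_ite_eq, Finset.mem_univ, if_true]
    by_cases hij : i = j
    · subst hij
      simp
      ring
    · simp [hij, Ne.symm hij]
      ring
  all_goals
    simp [geodesicPart, geodesicMatrix, wedge, dilation, scaledFlow]
  ring

theorem potentialPart_eq_wedge {n : ℕ} (a : ℝ) {x : Phase n} (hx : x ∈ domain n) :
    potentialPart (potentialMatrix a) x = wedge dilation (scaledFlow 0 1 a) x := by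
  ext i j
  cases i <;> cases j
  case inr.inr i j =>
    simp only [potentialPart, Matrix.fromBlocks_apply₂₂, Matrix.of_apply,
      partialDeriv_potentialMatrix a (show pos x ∈ collisionFree n from hx),
      partialDeriv_force_comm a (show pos x ∈ collisionFree n from hx) j i, wedge, dilation,
      scaledFlow, Sum.elim_inr, Pi.smul_apply, smul_eq_mul, Pi.neg_apply]
    simp only [add_sub_add_left_eq_sub, sub_mul, mul_assoc, ite_mul, one_mul, zero_mul, mul_ite,
      mul_zero, Finset.sum_sub_distrib, Finset.sum_ite_eq, Finset.mem_univ, if_true]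
    ring
  all_goals
    simp [potentialPart, potentialMatrix_apply, wedge, dilation, scaledFlow]
  ring

/-- The identity `P' = (q, -p) ∧ P dH`. -/
theorem secondBivector_eq_wedge {n : ℕ} (a : ℝ) {x : Phase n} (hx : x ∈ domain n) :
    secondBivector n a x = wedge dilation (scaledFlow 1 1 a) x := by
  rw [secondBivector, naturalBivector, geodesicPart_eq_wedge a, potentialPart_eq_wedge a hx]
  ext i j
  cases i <;> cases j <;> simp [wedge, scaledFlow] <;> ring

theorem isPoissonOn_secondBivector (n : ℕ) (a : ℝ) :
    IsPoissonOn (domain n) (secondBivector n a) :=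
  isPoissonOn_wedge_scaledFlow 1 1 a fun _ hx => secondBivector_eq_wedge a hx

theorem isNaturalPoissonOn_collisionFree (n : ℕ) (a : ℝ) :
    IsNaturalPoissonOn (collisionFree n) geodesicMatrix (potentialMatrix a) where
  torsion_geodesic := nijenhuis_geodesicMatrix
  torsion_potential _ hq := nijenhuis_potentialMatrix a hq
  poisson_geodesic := isPoissonOn_wedge_scaledFlow 1 0 a fun x _ => geodesicPart_eq_wedge a x
  poisson_potential := isPoissonOn_wedge_scaledFlow 0 1 a fun _ hx => potentialPart_eq_wedge a hx
  poisson := isPoissonOn_secondBivector n a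

/-! ### Compatibility with the canonical bivector -/

theorem canonical_transpose {n : ℕ} (x : Phase n) :
    (canonical n x).transpose = -canonical n x := by
  simp [canonical, Matrix.fromBlocks_transpose, Matrix.fromBlocks_neg]

theorem isPoissonOn_canonical {n : ℕ} (U : Set (Phase n)) : IsPoissonOn U (canonical n) where
  smooth i j := contDiffOn_const
  antisymm x _ i j := by
    have h := congrFun (congrFun (canonical_transpose x) j) i
    simpa using h
  schouten_self x _ i j k := by simp [schouten, canonical, partialDeriv]

theorem pos_canonical_col_inl {n : ℕ} (x : Phase n) (i : Fin n) :
    pos (fun l => canonical n x l (Sum.inl i)) = 0 := by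
  funext k
  simp [pos, canonical]

theorem mom_canonical_col_inl {n : ℕ} (x : Phase n) (i : Fin n) :
    mom (fun l => canonical n x l (Sum.inl i)) = -Pi.single i 1 := by
  funext k
  simp [mom, canonical, Matrix.one_apply, Pi.single_apply]

theorem pos_canonical_col_inr {n : ℕ} (x : Phase n) (i : Fin n) :
    pos (fun l => canonical n x l (Sum.inr i)) = Pi.single i 1 := by
  funext k
  simp [pos, canonical, Matrix.one_apply, Pi.single_apply]

theorem mom_canonical_col_inr {n : ℕ} (x : Phase n) (i : Fin n) :
    mom (fun l => canonical n x l (Sum.inr i)) = 0 := by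
  funext k
  simp [mom, canonical]

theorem schouten_canonical_secondBivector {n : ℕ} (a : ℝ) {x : Phase n} (hx : x ∈ domain n)
    (i j k : Fin n ⊕ Fin n) :
    schouten (canonical n) (secondBivector n a) x i j k = 0 := by
  have he : secondBivector n a =ᶠ[nhds x] wedge dilation (scaledFlow 1 1 a) := by
    filter_upwards [(isOpen_domain n).mem_nhds hx] with y hy using secondBivector_eq_wedge a hy
  rw [schouten_congr (Filter.EventuallyEq.refl _ _) he]
  refine schouten_const_wedge (P := canonical n x)
    (fun i => (contDiff_dilation i).differentiable (by simp) x)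
    (fun i => differentiableAt_of_contDiffOn_domain (contDiffOn_scaledFlow 1 1 a i) hx) ?_ ?_ i j k
  · intro i j
    rw [fderiv_dilation, fderiv_dilation]
    cases i <;> cases j <;>
      simp [dilation, pos_canonical_col_inl, mom_canonical_col_inl, pos_canonical_col_inr,
        mom_canonical_col_inr, Pi.single_apply, eq_comm]
  · intro i j
    rw [fderiv_scaledFlow 1 1 a hx, fderiv_scaledFlow 1 1 a hx]
    cases i <;> cases j <;>
      simp [pos_canonical_col_inl, mom_canonical_col_inl, pos_canonical_col_inr,
        mom_canonical_col_inr, forceDeriv_zero, Pi.single_apply, eq_comm]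
    exact forceDeriv_single_comm a _ _ _

theorem areCompatibleOn_domain (n : ℕ) (a : ℝ) :
    AreCompatibleOn (domain n) (canonical n) (secondBivector n a) where
  left := isPoissonOn_canonical _
  right := isPoissonOn_secondBivector n a
  schouten_eq_zero _ hx := schouten_canonical_secondBivector a hx

/-! ### Entrywise derivatives of matrix curves -/

/-- The matrix curve `A` has derivative `A'` at `t`. Differentiability is entrywise, so that no norm
on matrices has to be chosen. -/
def HasEntrywiseDerivAt {ι : Type*} (A : ℝ → Matrix ι ι ℝ) (A' : Matrix ι ι ℝ) (t : ℝ) : Prop :=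
  ∀ i j, HasDerivAt (fun s => A s i j) (A' i j) t

namespace HasEntrywiseDerivAt

variable {ι : Type*} [Fintype ι] {A B : ℝ → Matrix ι ι ℝ} {A' B' : Matrix ι ι ℝ}
  {t : ℝ}

theorem mul (hA : HasEntrywiseDerivAt A A' t) (hB : HasEntrywiseDerivAt B B' t) :
    HasEntrywiseDerivAt (fun s => A s * B s) (A' * B t + A t * B') t := by
  intro i j
  simp only [Matrix.mul_apply, Matrix.add_apply, ← Finset.sum_add_distrib]
  exact HasDerivAt.fun_sum fun k _ => (hA i k).fun_mul (hB k j)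

theorem trace (hA : HasEntrywiseDerivAt A A' t) :
    HasDerivAt (fun s => (A s).trace) A'.trace t :=
  HasDerivAt.fun_sum fun i _ => hA i i

/-- The weight `C`, commuting with `A t`, makes the induction over powers go through. -/
theorem exists_pow_succ [DecidableEq ι] (hA : HasEntrywiseDerivAt A A' t) (k : ℕ) :
    ∃ D, HasEntrywiseDerivAt (fun s => A s ^ (k + 1)) D t ∧
      ∀ C, Commute C (A t) → (C * D).trace = (k + 1) * (C * A t ^ k * A').trace := by
  induction k with
  | zero => exact ⟨A', by simpa using hA, by simp⟩
  | succ k ih =>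
    obtain ⟨D, hD, hC⟩ := ih
    refine ⟨D * A t + A t ^ (k + 1) * A', by simpa only [pow_succ _ (k + 1)] using hD.mul hA, ?_⟩
    intro C hCA
    have h := hC (A t * C) ((Commute.refl _).mul_left hCA)
    rw [mul_add, Matrix.trace_add, ← mul_assoc, Matrix.trace_mul_comm, ← mul_assoc, h, ← mul_assoc,
      ← hCA.eq, mul_assoc C, ← pow_succ']
    push_cast
    ring

theorem trace_pow_succ [DecidableEq ι] (hA : HasEntrywiseDerivAt A A' t) (k : ℕ) :
    HasDerivAt (fun s => (A s ^ (k + 1)).trace) ((k + 1) * (A t ^ k * A').trace) t := by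
  obtain ⟨D, hD, hC⟩ := hA.exists_pow_succ k
  have h := hC 1 (Commute.one_left _)
  rw [one_mul, one_mul] at h
  rw [← h]
  exact hD.trace

theorem pow_of_commutator [DecidableEq ι] {M : Matrix ι ι ℝ}
    (hA : HasEntrywiseDerivAt A (A t * M - M * A t) t) (k : ℕ) :
    HasEntrywiseDerivAt (fun s => A s ^ k) (A t ^ k * M - M * A t ^ k) t := by
  induction k with
  | zero =>
    intro i j
    simpa using hasDerivAt_const t ((1 : Matrix ι ι ℝ) i j)
  | succ k ih =>
    have h : (A t ^ k * M - M * A t ^ k) * A t + A t ^ k * (A t * M - M * A t)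
        = A t ^ (k + 1) * M - M * A t ^ (k + 1) := by
      rw [pow_succ]
      noncomm_ring
    rw [← h]
    simpa only [pow_succ] using ih.mul hA

theorem pow_of_eq_smul [DecidableEq ι] {c : ℝ} (hA : HasEntrywiseDerivAt A (c • A t) t) (k : ℕ) :
    HasEntrywiseDerivAt (fun s => A s ^ k) ((k * c) • A t ^ k) t := by
  induction k with
  | zero =>
    intro i j
    simpa using hasDerivAt_const t ((1 : Matrix ι ι ℝ) i j)
  | succ k ih =>
    have h : ((k * c) • A t ^ k) * A t + A t ^ k * (c • A t)
        = (((k + 1 : ℕ) : ℝ) * c) • A t ^ (k + 1) := by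
      rw [smul_mul_assoc, mul_smul_comm, ← pow_succ, ← add_smul]
      push_cast
      ring_nf
    rw [← h]
    simpa only [pow_succ] using ih.mul hA

end HasEntrywiseDerivAt

/-! ### Derivatives of the Lax matrix -/

/-- The derivative of the Lax matrix at `x` in the direction `v`. The second term vanishes on the
diagonal. -/
noncomputable def laxDeriv {n : ℕ} (a : ℝ) (x v : Phase n) : Matrix (Fin n) (Fin n) ℝ :=
  Matrix.of fun i j =>
    (if i = j then mom v i else 0) - a * (pos v i - pos v j) / (pos x i - pos x j) ^ 2

theorem hasEntrywiseDerivAt_lax {n : ℕ} (a : ℝ) {x : Phase n} (hx : x ∈ domain n) (v : Phase n) :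
    HasEntrywiseDerivAt (fun t : ℝ => lax a (x + t • v)) (laxDeriv a x v) 0 := by
  intro i j
  by_cases hij : i = j
  · subst hij
    simpa [lax, laxDeriv, mom] using
      (show HasDerivAt _ _ _ from hasLineDerivAt_apply (Sum.inr i) x v)
  · have hne : pos x i - pos x j ≠ 0 := sub_ne_zero.2 (hx i j hij)
    have h1 : HasDerivAt (fun t : ℝ => pos (x + t • v) i - pos (x + t • v) j)
        (pos v i - pos v j) 0 :=
      (show HasDerivAt _ _ _ from hasLineDerivAt_apply (Sum.inl i) x v).fun_sub
        (show HasDerivAt _ _ _ from hasLineDerivAt_apply (Sum.inl j) x v)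
    have h2 := (hasDerivAt_const (0 : ℝ) a).fun_div h1 (by simpa using hne)
    simp only [lax, laxDeriv, Matrix.of_apply, hij, if_false]
    refine h2.congr_deriv ?_
    simp only [zero_smul, add_zero]
    ring

theorem differentiableAt_lax_apply {n : ℕ} (a : ℝ) {x : Phase n} (hx : x ∈ domain n)
    (i j : Fin n) : DifferentiableAt ℝ (fun y => lax a y i j) x := by
  by_cases hij : i = j
  · simp only [lax, Matrix.of_apply, hij, if_true, mom]
    fun_prop
  · have hne : x (Sum.inl i) - x (Sum.inl j) ≠ 0 := sub_ne_zero.2 (hx i j hij)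
    simp only [lax, Matrix.of_apply, hij, if_false, pos]
    fun_prop (disch := exact hne)

theorem differentiableAt_lax_pow_apply {n : ℕ} (a : ℝ) {x : Phase n} (hx : x ∈ domain n) (k : ℕ)
    (i j : Fin n) : DifferentiableAt ℝ (fun y => (lax a y ^ k) i j) x := by
  induction k generalizing i j with
  | zero => simp
  | succ k ih =>
    simp only [pow_succ, Matrix.mul_apply]
    exact DifferentiableAt.fun_sum fun l _ => (ih i l).fun_mul (differentiableAt_lax_apply a hx l j)

theorem differentiableAt_laxIntegral {n : ℕ} (a : ℝ) {x : Phase n} (hx : x ∈ domain n) (k : ℕ) :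
    DifferentiableAt ℝ (laxIntegral a k) x := by
  have h : DifferentiableAt ℝ (fun y => ∑ i, (lax a y ^ k) i i) x :=
    DifferentiableAt.fun_sum fun i _ => differentiableAt_lax_pow_apply a hx k i i
  have h' := h.mul_const (k.factorial : ℝ)⁻¹
  exact h'

theorem fderiv_laxIntegral_succ {n : ℕ} (a : ℝ) {x : Phase n} (hx : x ∈ domain n) (k : ℕ)
    (v : Phase n) :
    fderiv ℝ (laxIntegral a (k + 1)) x v
      = (lax a x ^ k * laxDeriv a x v).trace / (k.factorial : ℝ) := by
  have h := ((hasEntrywiseDerivAt_lax a hx v).trace_pow_succ k).div_const ((k + 1).factorial : ℝ)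
  have he : fderiv ℝ (laxIntegral a (k + 1)) x v = _ :=
    fderiv_eq_of_hasLineDerivAt (differentiableAt_laxIntegral a hx (k + 1)) h
  have hk : (k.factorial : ℝ) ≠ 0 := by exact_mod_cast k.factorial_ne_zero
  rw [he, Nat.factorial_succ]
  simp only [zero_smul, add_zero]
  push_cast
  field_simp

/-! ### The Lax hierarchy -/

/-- The vector field attached to a matrix `B`. For `B = 𝓛ᵏ` it is the Hamiltonian field of
`trace 𝓛ᵏ⁺¹ / (k + 1)`. The summand `j = i` vanishes. -/
noncomputable def laxFlow {n : ℕ} (a : ℝ) (x : Phase n) (B : Matrix (Fin n) (Fin n) ℝ) : Phase n :=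
  Sum.elim (fun i => B i i) fun i => a * ∑ j, (B j i - B i j) / (pos x i - pos x j) ^ 2

/-- The second member of the Lax pair of the flow attached to `B`. Its rows sum to zero; off the
diagonal it is determined by `[Q, M] = diag B - B`, where `Q = diag (q)`. Quotients by
`q_i - q_i = 0` are zero, so the sum on the diagonal runs over `k ≠ i`. -/
noncomputable def laxPartner {n : ℕ} (x : Phase n) (B : Matrix (Fin n) (Fin n) ℝ) :
    Matrix (Fin n) (Fin n) ℝ :=
  Matrix.of fun i j =>
    (if i = j then ∑ k, B i k / (pos x i - pos x k) else 0) - B i j / (pos x i - pos x j)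

theorem trace_mul_laxDeriv {n : ℕ} (a : ℝ) (x v : Phase n) (B : Matrix (Fin n) (Fin n) ℝ) :
    (B * laxDeriv a x v).trace
      = ∑ i, (mom v i * pos (laxFlow a x B) i - pos v i * mom (laxFlow a x B) i) := by
  have h1 : (B * laxDeriv a x v).trace = ∑ i, mom v i * B i i
      - (∑ i, ∑ j, pos v j * (a * (B i j / (pos x j - pos x i) ^ 2))
        - ∑ i, ∑ j, pos v i * (a * (B i j / (pos x i - pos x j) ^ 2))) := by
    simp only [Matrix.trace, Matrix.diag_apply, Matrix.mul_apply, laxDeriv, Matrix.of_apply,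
      ← Finset.sum_sub_distrib]
    refine Finset.sum_congr rfl fun i _ => ?_
    have h2 : mom v i * B i i = ∑ j, B i j * (if j = i then mom v j else 0) := by
      simp [mul_comm]
    rw [h2, ← Finset.sum_sub_distrib]
    refine Finset.sum_congr rfl fun j _ => ?_
    rw [← neg_sub (pos x j) (pos x i), neg_sq]
    ring
  rw [h1, Finset.sum_comm (f := fun i j => pos v j * (a * (B i j / (pos x j - pos x i) ^ 2))),
    ← Finset.sum_sub_distrib, ← Finset.sum_sub_distrib]
  refine Finset.sum_congr rfl fun i _ => ?_
  simp only [laxFlow, pos, mom, Sum.elim_inl, Sum.elim_inr, Finset.mul_sum,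
    ← Finset.sum_sub_distrib]
  congr 1
  exact Finset.sum_congr rfl fun j _ => by ring

theorem hamVec_canonical {n : ℕ} (F : Phase n → ℝ) (x : Phase n) :
    hamVec (canonical n) F x
      = Sum.elim (fun i => partialDeriv (Sum.inr i) F x)
          (fun i => -partialDeriv (Sum.inl i) F x) := by
  have h : differential F x = Sum.elim (fun i => partialDeriv (Sum.inl i) F x)
      (fun i => partialDeriv (Sum.inr i) F x) := by
    funext i
    cases i <;> rfl
  rw [hamVec, h, canonical, Matrix.fromBlocks_mulVec]
  simp [Matrix.neg_mulVec]
  rfl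

theorem hamVec_canonical_laxIntegral {n : ℕ} (a : ℝ) {x : Phase n} (hx : x ∈ domain n) (k : ℕ) :
    hamVec (canonical n) (laxIntegral a (k + 1)) x
      = (1 / (k.factorial : ℝ)) • laxFlow a x (lax a x ^ k) := by
  rw [hamVec_canonical]
  funext i
  cases i with
  | inl i =>
    simp only [Sum.elim_inl, partialDeriv, fderiv_laxIntegral_succ a hx, trace_mul_laxDeriv,
      Pi.smul_apply, smul_eq_mul]
    rw [Finset.sum_eq_single i]
    · simp [pos, mom]
      ring
    · intro j _ hj
      simp [pos, mom, hj]
    · simp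
  | inr i =>
    simp only [Sum.elim_inr, partialDeriv, fderiv_laxIntegral_succ a hx, trace_mul_laxDeriv,
      Pi.smul_apply, smul_eq_mul]
    rw [Finset.sum_eq_single i]
    · simp [pos, mom]
      ring
    · intro j _ hj
      simp [pos, mom, hj]
    · simp

theorem diagonal_pos_laxFlow {n : ℕ} (a : ℝ) {x : Phase n} (hx : x ∈ domain n)
    (B : Matrix (Fin n) (Fin n) ℝ) :
    Matrix.diagonal (pos (laxFlow a x B))
      = Matrix.diagonal (pos x) * laxPartner x B - laxPartner x B * Matrix.diagonal (pos x)
        + B := by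
  ext i j
  simp only [Matrix.add_apply, Matrix.sub_apply, Matrix.diagonal_mul, Matrix.mul_diagonal,
    laxPartner, Matrix.of_apply]
  by_cases hij : i = j
  · subst hij
    simp [laxFlow, pos]
    ring
  · have hne : pos x i - pos x j ≠ 0 := sub_ne_zero.2 (hx i j hij)
    rw [Matrix.diagonal_apply_ne _ hij, if_neg hij]
    field_simp
    ring

/-- The moment map equation of the Calogero–Moser system. -/
theorem diagonal_pos_commutator_lax {n : ℕ} (a : ℝ) {x : Phase n} (hx : x ∈ domain n) :
    Matrix.diagonal (pos x) * lax a x - lax a x * Matrix.diagonal (pos x)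
      = a • (Matrix.of (fun _ _ => 1) - 1) := by
  ext i j
  simp only [Matrix.sub_apply, Matrix.diagonal_mul, Matrix.mul_diagonal, lax, Matrix.of_apply,
    Matrix.smul_apply, smul_eq_mul]
  by_cases hij : i = j
  · subst hij
    simp
    ring
  · have hne : pos x i - pos x j ≠ 0 := sub_ne_zero.2 (hx i j hij)
    rw [if_neg hij, Matrix.one_apply_ne hij]
    field_simp
    ring

theorem sum_laxPartner_row {n : ℕ} (x : Phase n) (B : Matrix (Fin n) (Fin n) ℝ) (i : Fin n) :
    ∑ j, laxPartner x B i j = 0 := by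
  simp [laxPartner, Finset.sum_sub_distrib]

/-- The column sum `∑ k, (B_kj + B_jk) / (q_j - q_k)` is, up to the factor `a`, the diagonal entry
`[𝓛, B]_jj`. -/
theorem mul_sum_laxPartner_col {n : ℕ} (a : ℝ) (x : Phase n) {B : Matrix (Fin n) (Fin n) ℝ}
    (hB : Commute (lax a x) B) (j : Fin n) : a * ∑ i, laxPartner x B i j = 0 := by
  have h1 : (lax a x * B - B * lax a x) j j = 0 := by
    rw [hB.eq, sub_self]
    rfl
  rw [← h1]
  simp only [laxPartner, Matrix.of_apply, Finset.sum_sub_distrib, Finset.sum_ite_eq',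
    Finset.mem_univ, if_true, Matrix.sub_apply, Matrix.mul_apply, mul_sub, Finset.mul_sum]
  rw [← Finset.sum_sub_distrib, ← Finset.sum_sub_distrib]
  refine Finset.sum_congr rfl fun k _ => ?_
  by_cases hjk : j = k
  · subst hjk
    simp
    ring
  · simp only [lax, Matrix.of_apply, hjk, Ne.symm hjk, if_false]
    rw [← neg_sub (pos x j) (pos x k)]
    simp only [div_neg]
    ring

/-- The Lax equation for the flow attached to a matrix `B` commuting with `𝓛`. Off the diagonal it
follows from the Jacobi identity for `[Q, [𝓛, M]]`, as `q_i - q_j ≠ 0`. -/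
theorem laxDeriv_laxFlow {n : ℕ} (a : ℝ) {x : Phase n} (hx : x ∈ domain n)
    {B : Matrix (Fin n) (Fin n) ℝ} (hB : Commute (lax a x) B) :
    laxDeriv a x (laxFlow a x B) = lax a x * laxPartner x B - laxPartner x B * lax a x := by
  set L := lax a x with hL
  set M := laxPartner x B with hM
  set Q := Matrix.diagonal (pos x) with hQ
  ext i j
  by_cases hij : i = j
  · subst hij
    simp only [Matrix.sub_apply, Matrix.mul_apply, laxDeriv, Matrix.of_apply, if_true, sub_self,
      mul_zero, zero_div, sub_zero, mom, laxFlow, Sum.elim_inr, Finset.mul_sum]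
    rw [← Finset.sum_sub_distrib]
    refine Finset.sum_congr rfl fun k _ => ?_
    by_cases hik : i = k
    · subst hik
      simp [mul_comm]
    · simp only [hL, hM, lax, laxPartner, Matrix.of_apply, hik, Ne.symm hik, if_false, zero_sub]
      rw [← neg_sub (pos x i) (pos x k)]
      have hne : pos x i - pos x k ≠ 0 := sub_ne_zero.2 (hx i k hik)
      rw [div_neg, div_neg]
      field_simp
  · have hne : pos x i - pos x j ≠ 0 := sub_ne_zero.2 (hx i j hij)
    have hJ : Q * (L * M - M * L) - (L * M - M * L) * Q
        = (Q * L - L * Q) * M - M * (Q * L - L * Q)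
          + (L * (Q * M - M * Q) - (Q * M - M * Q) * L) := by
      noncomm_ring
    have hQM : Q * M - M * Q = Matrix.diagonal (pos (laxFlow a x B)) - B := by
      rw [diagonal_pos_laxFlow a hx, add_sub_cancel_right]
    have hc : L * (Matrix.diagonal (pos (laxFlow a x B)) - B)
        - (Matrix.diagonal (pos (laxFlow a x B)) - B) * L
        = L * Matrix.diagonal (pos (laxFlow a x B))
          - Matrix.diagonal (pos (laxFlow a x B)) * L := by
      rw [mul_sub, sub_mul, hB.eq]
      abel
    rw [hQM, hc, diagonal_pos_commutator_lax a hx] at hJ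
    have hE : (a • (Matrix.of (fun _ _ => (1 : ℝ)) - 1)) * M
        - M * (a • (Matrix.of (fun _ _ => (1 : ℝ)) - 1))
        = a • (Matrix.of (fun _ _ => (1 : ℝ)) * M - M * Matrix.of (fun _ _ => (1 : ℝ))) := by
      rw [smul_mul_assoc, mul_smul_comm, ← smul_sub]
      noncomm_ring
    rw [hE] at hJ
    have hij' := congrFun (congrFun hJ i) j
    have hr := sum_laxPartner_row x B i
    have hcol := mul_sum_laxPartner_col a x hB j
    rw [← hM] at hr hcol
    simp only [Matrix.add_apply, Matrix.sub_apply, hQ, Matrix.diagonal_mul, Matrix.mul_diagonal,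
      Matrix.smul_apply, smul_eq_mul, Matrix.mul_apply (M := Matrix.of _),
      Matrix.mul_apply (N := Matrix.of _), Matrix.of_apply, one_mul, mul_one, hr, sub_zero, hcol,
      zero_add] at hij'
    have hLij : L i j = a / (pos x i - pos x j) := by
      simp [hL, lax, hij]
    rw [hLij] at hij'
    have h3 : (L * M - M * L) i j * (pos x i - pos x j)
        = -(a * (pos (laxFlow a x B) i - pos (laxFlow a x B) j)) / (pos x i - pos x j) := by
      rw [Matrix.sub_apply]
      linear_combination hij'
    rw [eq_div_iff hne] at h3
    simp only [laxDeriv, Matrix.of_apply, hij, if_false, zero_sub]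
    rw [← neg_div, div_eq_iff (pow_ne_zero 2 hne)]
    linear_combination -h3

theorem laxDeriv_dilation {n : ℕ} (a : ℝ) {x : Phase n} (hx : x ∈ domain n) :
    laxDeriv a x (dilation x) = (-1 : ℝ) • lax a x := by
  ext i j
  simp only [laxDeriv, lax, Matrix.of_apply, Matrix.smul_apply, smul_eq_mul]
  by_cases hij : i = j
  · subst hij
    simp [dilation, mom]
  · have hne : pos x i - pos x j ≠ 0 := sub_ne_zero.2 (hx i j hij)
    have hp : pos (dilation x) = pos x := rfl
    rw [if_neg hij, if_neg hij, hp]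
    field_simp
    ring

theorem scaledFlow_one_one {n : ℕ} (a : ℝ) (x : Phase n) :
    scaledFlow 1 1 a x = laxFlow a x (lax a x) := by
  funext i
  cases i with
  | inl i => simp [scaledFlow, laxFlow, lax]
  | inr i =>
    simp only [scaledFlow, laxFlow, Sum.elim_inr, one_smul, force, Finset.mul_sum]
    refine Finset.sum_congr rfl fun j _ => ?_
    by_cases hij : i = j
    · simp [hij]
    · simp only [lax, Matrix.of_apply, hij, Ne.symm hij, if_false]
      rw [← neg_sub (pos x i) (pos x j), div_neg]
      generalize pos x i - pos x j = d
      ring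

/-! ### The integrals `H_k` -/

theorem fderiv_laxIntegral_laxFlow {n : ℕ} (a : ℝ) {x : Phase n} (hx : x ∈ domain n) {k : ℕ}
    (hk : 1 ≤ k) {B : Matrix (Fin n) (Fin n) ℝ} (hB : Commute (lax a x) B) :
    fderiv ℝ (laxIntegral a k) x (laxFlow a x B) = 0 := by
  obtain ⟨k, rfl⟩ := Nat.exists_eq_add_of_le' hk
  rw [fderiv_laxIntegral_succ a hx, laxDeriv_laxFlow a hx hB, mul_sub, ← mul_assoc, ← mul_assoc,
    Matrix.trace_sub, Matrix.trace_mul_cycle (lax a x ^ k) (laxPartner x B), ← pow_succ',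
    ← pow_succ, sub_self, zero_div]

theorem fderiv_laxIntegral_scaledFlow {n : ℕ} (a : ℝ) {x : Phase n} (hx : x ∈ domain n) {k : ℕ}
    (hk : 1 ≤ k) : fderiv ℝ (laxIntegral a k) x (scaledFlow 1 1 a x) = 0 := by
  rw [scaledFlow_one_one]
  exact fderiv_laxIntegral_laxFlow a hx hk (Commute.refl _)

theorem fderiv_laxIntegral_dilation {n : ℕ} (a : ℝ) {x : Phase n} (hx : x ∈ domain n) {k : ℕ}
    (hk : 1 ≤ k) : fderiv ℝ (laxIntegral a k) x (dilation x) = -k * laxIntegral a k x := by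
  obtain ⟨k, rfl⟩ := Nat.exists_eq_add_of_le' hk
  have hf : (k.factorial : ℝ) ≠ 0 := by exact_mod_cast k.factorial_ne_zero
  rw [fderiv_laxIntegral_succ a hx, laxDeriv_dilation a hx, mul_smul_comm, ← pow_succ,
    Matrix.trace_smul, laxIntegral, Nat.factorial_succ]
  push_cast
  field_simp
  simp

theorem sum_sum_eq_two_mul_sum_lt {n : ℕ} (f : Fin n → Fin n → ℝ) (hf : ∀ i j, f i j = f j i)
    (h0 : ∀ i, f i i = 0) :
    ∑ i, ∑ j, f i j = 2 * ∑ i, ∑ j, if i < j then f i j else 0 := by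
  have h : ∀ i j, f i j = (if i < j then f i j else 0) + if j < i then f j i else 0 := by
    intro i j
    rcases lt_trichotomy i j with hij | hij | hij
    · simp [hij, hij.not_gt]
    · simp [hij, h0]
    · simp [hij, hij.not_gt, hf i j]
  calc ∑ i, ∑ j, f i j
      = ∑ i, ∑ j, ((if i < j then f i j else 0) + if j < i then f j i else 0) :=
        Finset.sum_congr rfl fun i _ => Finset.sum_congr rfl fun j _ => h i j
    _ = (∑ i, ∑ j, if i < j then f i j else 0) + ∑ i, ∑ j, if j < i then f j i else 0 := by
        simp only [Finset.sum_add_distrib]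
    _ = 2 * ∑ i, ∑ j, if i < j then f i j else 0 := by
        rw [Finset.sum_comm (f := fun i j => if j < i then f j i else 0)]
        ring

theorem hamiltonian_eq_laxIntegral {n : ℕ} (a : ℝ) (x : Phase n) :
    hamiltonian a x = laxIntegral a 2 x := by
  have h : (lax a x ^ 2).trace
      = ∑ i, mom x i ^ 2 - a ^ 2 * ∑ i, ∑ j, 1 / (pos x i - pos x j) ^ 2 := by
    rw [Finset.mul_sum, ← Finset.sum_sub_distrib, pow_two]
    simp only [Matrix.trace, Matrix.diag_apply, Matrix.mul_apply, Finset.mul_sum]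
    refine Finset.sum_congr rfl fun i _ => ?_
    have h2 : mom x i ^ 2 = ∑ j, if i = j then mom x i ^ 2 else 0 := by simp
    rw [h2, ← Finset.sum_sub_distrib]
    refine Finset.sum_congr rfl fun j _ => ?_
    by_cases hij : i = j
    · subst hij
      simp [lax]
      ring
    · simp only [lax, Matrix.of_apply, hij, Ne.symm hij, if_false]
      rw [← neg_sub (pos x i) (pos x j), div_neg]
      generalize pos x i - pos x j = d
      ring
  rw [laxIntegral, h, sum_sum_eq_two_mul_sum_lt, hamiltonian, Nat.factorial_two]
  · push_cast
    ring
  · intro i j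
    rw [← neg_sub (pos x i) (pos x j), neg_sq]
  · simp

theorem hamiltonian_eq {n : ℕ} (a : ℝ) : (hamiltonian a : Phase n → ℝ) = laxIntegral a 2 :=
  funext (hamiltonian_eq_laxIntegral a)

theorem hamVec_canonical_hamiltonian {n : ℕ} (a : ℝ) {x : Phase n} (hx : x ∈ domain n) :
    hamVec (canonical n) (hamiltonian a) x = scaledFlow 1 1 a x := by
  rw [hamiltonian_eq, hamVec_canonical_laxIntegral a hx 1, scaledFlow_one_one]
  simp

/-- Euler's identity for `H`, which has weight `-2` under the dilations. -/
theorem sum_mom_sq_add_pos_mul_force {n : ℕ} (a : ℝ) {x : Phase n} (hx : x ∈ domain n) :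
    ∑ i, (mom x i * mom x i + pos x i * force a (pos x) i) = 2 * hamiltonian a x := by
  have h := fderiv_laxIntegral_dilation a hx one_le_two
  have hd : fderiv ℝ (laxIntegral a 2) x (dilation x) = _ :=
    fderiv_laxIntegral_succ a hx 1 (dilation x)
  rw [hd, pow_one, trace_mul_laxDeriv, ← scaledFlow_one_one] at h
  simp only [dilation, scaledFlow, pos, mom, Sum.elim_inl, Sum.elim_inr, one_smul, Pi.neg_apply,
    Nat.factorial_one, Nat.cast_one, div_one] at h
  rw [hamiltonian_eq_laxIntegral, ← neg_inj, ← Finset.sum_neg_distrib]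
  push_cast at h
  rw [← neg_mul, ← h]
  exact Finset.sum_congr rfl fun i _ => by simp only [mom, pos]; ring

/-! ### The recursion operator -/

theorem inv_canonical {n : ℕ} (x : Phase n) : (canonical n x)⁻¹ = -canonical n x := by
  refine Matrix.inv_eq_right_inv ?_
  simp [canonical, Matrix.fromBlocks_neg, Matrix.fromBlocks_multiply]

theorem canonical_mulVec_dotProduct {n : ℕ} (x v w : Phase n) :
    (canonical n x).mulVec v ⬝ᵥ w = -(v ⬝ᵥ (canonical n x).mulVec w) := by
  rw [Matrix.dotProduct_mulVec, ← Matrix.mulVec_transpose, canonical_transpose,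
    Matrix.neg_mulVec, neg_dotProduct, neg_neg]

theorem wedge_eq_vecMulVec {n : ℕ} (A B : Phase n → Phase n) (x : Phase n) :
    wedge A B x = Matrix.vecMulVec (A x) (B x) - Matrix.vecMulVec (B x) (A x) := by
  ext i j
  simp [wedge, Matrix.vecMulVec_apply]

theorem canonical_mulVec_dilation_dotProduct {n : ℕ} (a : ℝ) {x : Phase n} (hx : x ∈ domain n) :
    (canonical n x).mulVec (dilation x) ⬝ᵥ scaledFlow 1 1 a x = -(2 * hamiltonian a x) := by
  rw [← sum_mom_sq_add_pos_mul_force a hx, canonical, dilation, Matrix.fromBlocks_mulVec]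
  simp [dotProduct, scaledFlow, Matrix.neg_mulVec, Finset.sum_add_distrib]
  ring

theorem recursionOperator_eq {n : ℕ} (a : ℝ) {x : Phase n} (hx : x ∈ domain n) :
    recursionOperator (secondBivector n a) x
      = Matrix.vecMulVec (dilation x) ((canonical n x).mulVec (scaledFlow 1 1 a x))
        - Matrix.vecMulVec (scaledFlow 1 1 a x) ((canonical n x).mulVec (dilation x)) := by
  have h : ∀ v : Phase n, Matrix.vecMul v (-canonical n x) = (canonical n x).mulVec v := by
    intro v
    rw [← canonical_transpose, Matrix.vecMul_transpose]
  rw [recursionOperator, secondBivector_eq_wedge a hx, wedge_eq_vecMulVec, inv_canonical, sub_mul,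
    Matrix.vecMulVec_mul, Matrix.vecMulVec_mul, h, h]

/-- `N` acts as the scalar `2 H` on the plane spanned by `(q, -p)` and `P dH`, and takes its values
in that plane. -/
theorem recursionOperator_sq {n : ℕ} (a : ℝ) {x : Phase n} (hx : x ∈ domain n) :
    recursionOperator (secondBivector n a) x * recursionOperator (secondBivector n a) x
      = (2 * hamiltonian a x) • recursionOperator (secondBivector n a) x := by
  have h0 : ∀ v : Phase n, (canonical n x).mulVec v ⬝ᵥ v = 0 := by
    intro v
    have h := canonical_mulVec_dotProduct x v v
    rw [dotProduct_comm v] at h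
    linarith
  have h1 := canonical_mulVec_dilation_dotProduct a hx
  have h2 : (canonical n x).mulVec (scaledFlow 1 1 a x) ⬝ᵥ dilation x = 2 * hamiltonian a x := by
    rw [canonical_mulVec_dotProduct, dotProduct_comm, h1, neg_neg]
  rw [recursionOperator_eq a hx, sub_mul, mul_sub, mul_sub]
  simp only [Matrix.vecMulVec_mul_vecMulVec, h0, h1, h2]
  simp only [zero_smul, neg_smul, Matrix.vecMulVec_zero, Matrix.vecMulVec_neg,
    Matrix.vecMulVec_smul, smul_sub]
  abel

theorem trace_recursionOperator_pow {n : ℕ} (a : ℝ) {x : Phase n} (hx : x ∈ domain n) {k : ℕ}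
    (hk : 1 ≤ k) :
    (recursionOperator (secondBivector n a) x ^ k).trace = 2 * (2 * hamiltonian a x) ^ k := by
  have hpow : ∀ k, recursionOperator (secondBivector n a) x ^ (k + 1)
      = (2 * hamiltonian a x) ^ k • recursionOperator (secondBivector n a) x := by
    intro k
    induction k with
    | zero => simp
    | succ k ih => rw [pow_succ, ih, smul_mul_assoc, recursionOperator_sq a hx, smul_smul, pow_succ]
  have htr : (recursionOperator (secondBivector n a) x).trace = 2 * (2 * hamiltonian a x) := by
    have h := canonical_mulVec_dilation_dotProduct a hx
    rw [recursionOperator_eq a hx, Matrix.trace_sub, Matrix.trace_vecMulVec,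
      Matrix.trace_vecMulVec, dotProduct_comm, canonical_mulVec_dotProduct,
      dotProduct_comm (scaledFlow 1 1 a x), h]
    ring
  obtain ⟨k, rfl⟩ := Nat.exists_eq_add_of_le' hk
  rw [hpow, Matrix.trace_smul, htr, smul_eq_mul]
  ring

/-! ### The functions `g_m` and the integrals `K_m` -/

/-- The closed form `g_{m+1} = trace (Q 𝓛ᵐ) / m!`, with `Q = diag (q)`. -/
theorem auxG_succ {n : ℕ} (a : ℝ) {x : Phase n} (hx : x ∈ domain n) (m : ℕ) :
    auxG a (m + 1) x = (Matrix.diagonal (pos x) * lax a x ^ m).trace / (m.factorial : ℝ) := by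
  have hd : ∀ v, fderiv ℝ (fun y : Phase n => ∑ j, pos y j ^ 2) x v
      = ∑ j, 2 * pos x j * pos v j := by
    intro v
    refine fderiv_eq_of_hasLineDerivAt (by unfold pos; fun_prop) ?_
    refine HasDerivAt.fun_sum (A := fun j (t : ℝ) => pos (x + t • v) j ^ 2) fun j _ => ?_
    have h := (show HasDerivAt _ _ _ from hasLineDerivAt_apply (Sum.inl j) x v).fun_pow 2
    refine h.congr_deriv ?_
    simp [pos]
  rw [auxG, bracket, differential_dotProduct, hd, hamVec_canonical_laxIntegral a hx]
  simp only [Matrix.trace, Matrix.diag_apply, Matrix.diagonal_mul, Finset.mul_sum, Finset.sum_div]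
  refine Finset.sum_congr rfl fun j _ => ?_
  simp [pos, laxFlow]
  ring

theorem auxG_succ_eventuallyEq {n : ℕ} (a : ℝ) {x : Phase n} (hx : x ∈ domain n) (m : ℕ) :
    auxG a (m + 1) =ᶠ[nhds x]
      fun y => (Matrix.diagonal (pos y) * lax a y ^ m).trace / (m.factorial : ℝ) := by
  filter_upwards [(isOpen_domain n).mem_nhds hx] with y hy using auxG_succ a hy m

theorem differentiableAt_auxG_succ {n : ℕ} (a : ℝ) {x : Phase n} (hx : x ∈ domain n) (m : ℕ) :
    DifferentiableAt ℝ (auxG a (m + 1)) x := by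
  refine DifferentiableAt.congr_of_eventuallyEq ?_ (auxG_succ_eventuallyEq a hx m)
  simp only [Matrix.trace, Matrix.diag_apply, Matrix.diagonal_mul, div_eq_mul_inv, pos]
  refine DifferentiableAt.mul_const (DifferentiableAt.fun_sum fun i _ => ?_) _
  exact DifferentiableAt.fun_mul (by fun_prop) (differentiableAt_lax_pow_apply a hx m i i)

theorem fderiv_auxG_succ {n : ℕ} (a : ℝ) {x : Phase n} (hx : x ∈ domain n) (m : ℕ)
    (v : Phase n) {D : Matrix (Fin n) (Fin n) ℝ}
    (hD : HasEntrywiseDerivAt (fun t : ℝ => lax a (x + t • v) ^ m) D 0) :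
    fderiv ℝ (auxG a (m + 1)) x v
      = (Matrix.diagonal (pos v) * lax a x ^ m + Matrix.diagonal (pos x) * D).trace
          / (m.factorial : ℝ) := by
  have hQ : HasEntrywiseDerivAt (fun t : ℝ => Matrix.diagonal (pos (x + t • v)))
      (Matrix.diagonal (pos v)) 0 := by
    intro i j
    by_cases hij : i = j
    · subst hij
      simpa [pos] using (show HasDerivAt _ _ _ from hasLineDerivAt_apply (Sum.inl i) x v)
    · simpa [Matrix.diagonal_apply_ne _ hij] using hasDerivAt_const (0 : ℝ) (0 : ℝ)
  rw [(auxG_succ_eventuallyEq a hx m).fderiv_eq]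
  refine fderiv_eq_of_hasLineDerivAt
    ((auxG_succ_eventuallyEq a hx m).differentiableAt_iff.1 (differentiableAt_auxG_succ a hx m)) ?_
  have h := (hQ.mul hD).trace.div_const (m.factorial : ℝ)
  simp only [zero_smul, add_zero] at h
  exact h

theorem hasEntrywiseDerivAt_lax_pow_laxFlow {n : ℕ} (a : ℝ) {x : Phase n} (hx : x ∈ domain n)
    (m : ℕ) :
    HasEntrywiseDerivAt (fun t : ℝ => lax a (x + t • laxFlow a x (lax a x)) ^ m)
      (lax a x ^ m * laxPartner x (lax a x) - laxPartner x (lax a x) * lax a x ^ m) 0 := by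
  have hL := hasEntrywiseDerivAt_lax a hx (laxFlow a x (lax a x))
  rw [laxDeriv_laxFlow a hx (Commute.refl _)] at hL
  have h0 : lax a (x + (0 : ℝ) • laxFlow a x (lax a x)) = lax a x := by simp
  have h := HasEntrywiseDerivAt.pow_of_commutator (t := 0) (M := laxPartner x (lax a x))
    (A := fun t : ℝ => lax a (x + t • laxFlow a x (lax a x))) (by rwa [h0]) m
  rwa [h0] at h

theorem hasEntrywiseDerivAt_lax_pow_dilation {n : ℕ} (a : ℝ) {x : Phase n} (hx : x ∈ domain n)
    (m : ℕ) :
    HasEntrywiseDerivAt (fun t : ℝ => lax a (x + t • dilation x) ^ m)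
      ((m * (-1 : ℝ)) • lax a x ^ m) 0 := by
  have hL := hasEntrywiseDerivAt_lax a hx (dilation x)
  rw [laxDeriv_dilation a hx] at hL
  have h0 : lax a (x + (0 : ℝ) • dilation x) = lax a x := by simp
  have h := HasEntrywiseDerivAt.pow_of_eq_smul (t := 0) (c := -1)
    (A := fun t : ℝ => lax a (x + t • dilation x)) (by rwa [h0]) m
  rwa [h0] at h

theorem fderiv_auxG_scaledFlow {n : ℕ} (a : ℝ) {x : Phase n} (hx : x ∈ domain n) {m : ℕ}
    (hm : 1 ≤ m) : fderiv ℝ (auxG a m) x (scaledFlow 1 1 a x) = m * laxIntegral a m x := by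
  obtain ⟨m, rfl⟩ := Nat.exists_eq_add_of_le' hm
  rw [scaledFlow_one_one, fderiv_auxG_succ a hx m _ (hasEntrywiseDerivAt_lax_pow_laxFlow a hx m),
    diagonal_pos_laxFlow a hx]
  generalize laxPartner x (lax a x) = M
  generalize Matrix.diagonal (pos x) = Q
  have h : ((Q * M - M * Q + lax a x) * lax a x ^ m
      + Q * (lax a x ^ m * M - M * lax a x ^ m)).trace = (lax a x ^ (m + 1)).trace := by
    have h' : (Q * M - M * Q + lax a x) * lax a x ^ m
        + Q * (lax a x ^ m * M - M * lax a x ^ m)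
        = (Q * lax a x ^ m) * M - M * (Q * lax a x ^ m) + lax a x ^ (m + 1) := by
      rw [pow_succ']
      noncomm_ring
    rw [h', Matrix.trace_add, Matrix.trace_sub, Matrix.trace_mul_comm M, sub_self, zero_add]
  have hf : (m.factorial : ℝ) ≠ 0 := by exact_mod_cast m.factorial_ne_zero
  rw [h, laxIntegral, Nat.factorial_succ]
  push_cast
  field_simp

theorem fderiv_auxG_dilation {n : ℕ} (a : ℝ) {x : Phase n} (hx : x ∈ domain n) {m : ℕ}
    (hm : 1 ≤ m) : fderiv ℝ (auxG a m) x (dilation x) = (2 - m) * auxG a m x := by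
  obtain ⟨m, rfl⟩ := Nat.exists_eq_add_of_le' hm
  have hp : pos (dilation x) = pos x := rfl
  rw [fderiv_auxG_succ a hx m _ (hasEntrywiseDerivAt_lax_pow_dilation a hx m),
    auxG_succ a hx, hp, mul_smul_comm, Matrix.trace_add, Matrix.trace_smul, smul_eq_mul]
  push_cast
  ring

theorem differentiableAt_extraIntegral {n : ℕ} (a : ℝ) {x : Phase n} (hx : x ∈ domain n) {m : ℕ}
    (hm : 1 ≤ m) : DifferentiableAt ℝ (extraIntegral a m) x := by
  obtain ⟨m, rfl⟩ := Nat.exists_eq_add_of_le' hm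
  exact (((differentiableAt_auxG_succ a hx 0).const_mul _).fun_mul
    (differentiableAt_laxIntegral a hx _)).fun_sub
      ((differentiableAt_auxG_succ a hx m).fun_mul (differentiableAt_laxIntegral a hx 1))

theorem fderiv_extraIntegral {n : ℕ} (a : ℝ) {x : Phase n} (hx : x ∈ domain n) {m : ℕ}
    (hm : 1 ≤ m) (v : Phase n) :
    fderiv ℝ (extraIntegral a m) x v
      = m * (auxG a 1 x * fderiv ℝ (laxIntegral a m) x v
          + laxIntegral a m x * fderiv ℝ (auxG a 1) x v)
        - (auxG a m x * fderiv ℝ (laxIntegral a 1) x v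
          + laxIntegral a 1 x * fderiv ℝ (auxG a m) x v) := by
  obtain ⟨m, rfl⟩ := Nat.exists_eq_add_of_le' hm
  have h1 : DifferentiableAt ℝ (auxG a 1) x := differentiableAt_auxG_succ a hx 0
  have h2 := differentiableAt_auxG_succ a hx m
  have h3 := differentiableAt_laxIntegral a hx 1
  have h4 := differentiableAt_laxIntegral a hx (m + 1)
  have he : (extraIntegral a (m + 1) : Phase n → ℝ)
      = fun y => ((m + 1 : ℕ) : ℝ) * auxG a 1 y * laxIntegral a (m + 1) y
        - auxG a (m + 1) y * laxIntegral a 1 y := rfl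
  rw [he, fderiv_fun_sub ((h1.const_mul _).fun_mul h4) (h2.fun_mul h3),
    fderiv_fun_mul (h1.const_mul _) h4, fderiv_fun_mul h2 h3, fderiv_const_mul h1]
  simp
  ring

theorem fderiv_extraIntegral_scaledFlow {n : ℕ} (a : ℝ) {x : Phase n} (hx : x ∈ domain n) {m : ℕ}
    (hm : 1 ≤ m) : fderiv ℝ (extraIntegral a m) x (scaledFlow 1 1 a x) = 0 := by
  rw [fderiv_extraIntegral a hx hm, fderiv_auxG_scaledFlow a hx hm,
    fderiv_auxG_scaledFlow a hx le_rfl, fderiv_laxIntegral_scaledFlow a hx hm,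
    fderiv_laxIntegral_scaledFlow a hx le_rfl]
  push_cast
  ring

theorem fderiv_extraIntegral_dilation {n : ℕ} (a : ℝ) {x : Phase n} (hx : x ∈ domain n) {m : ℕ}
    (hm : 1 ≤ m) :
    fderiv ℝ (extraIntegral a m) x (dilation x) = -((m : ℝ) - 1) * extraIntegral a m x := by
  rw [fderiv_extraIntegral a hx hm, fderiv_auxG_dilation a hx hm,
    fderiv_auxG_dilation a hx le_rfl, fderiv_laxIntegral_dilation a hx hm,
    fderiv_laxIntegral_dilation a hx le_rfl, extraIntegral]
  push_cast
  ring

/-! ### Bi-involution and the bi-Hamiltonian relations -/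

theorem bracket_canonical_laxIntegral {n : ℕ} (a : ℝ) {x : Phase n} (hx : x ∈ domain n) {k l : ℕ}
    (hk : 1 ≤ k) (hl : 1 ≤ l) :
    bracket (canonical n) (laxIntegral a k) (laxIntegral a l) x = 0 := by
  obtain ⟨l, rfl⟩ := Nat.exists_eq_add_of_le' hl
  rw [bracket, differential_dotProduct, hamVec_canonical_laxIntegral a hx, map_smul,
    fderiv_laxIntegral_laxFlow a hx hk ((Commute.refl _).pow_right l), smul_zero]

theorem hamVec_secondBivector {n : ℕ} (a : ℝ) {x : Phase n} (hx : x ∈ domain n)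
    (F : Phase n → ℝ) :
    hamVec (secondBivector n a) F x
      = fderiv ℝ F x (scaledFlow 1 1 a x) • dilation x
        - fderiv ℝ F x (dilation x) • scaledFlow 1 1 a x := by
  rw [hamVec, secondBivector_eq_wedge a hx, wedge_mulVec, differential_dotProduct,
    differential_dotProduct]

theorem bracket_secondBivector_laxIntegral {n : ℕ} (a : ℝ) {x : Phase n} (hx : x ∈ domain n)
    {k l : ℕ} (hk : 1 ≤ k) (hl : 1 ≤ l) :
    bracket (secondBivector n a) (laxIntegral a k) (laxIntegral a l) x = 0 := by
  rw [bracket, differential_dotProduct, hamVec_secondBivector a hx, map_sub, map_smul, map_smul,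
    fderiv_laxIntegral_scaledFlow a hx hk, fderiv_laxIntegral_scaledFlow a hx hl]
  simp

/-- An integral `F` of weight `-c` satisfies `P' dF = c F P dH`. -/
theorem hamVec_canonical_eq_of_weight {n : ℕ} (a : ℝ) {x : Phase n} (hx : x ∈ domain n)
    {F : Phase n → ℝ} {c : ℝ} (hc : c ≠ 0) (hF : DifferentiableAt ℝ F x) (hFx : F x ≠ 0)
    (hX : fderiv ℝ F x (scaledFlow 1 1 a x) = 0) (hD : fderiv ℝ F x (dilation x) = -c * F x) :
    hamVec (canonical n) (hamiltonian a) x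
      = (1 / c) • hamVec (secondBivector n a) (fun y => Real.log (F y)) x := by
  rw [hamVec_canonical_hamiltonian a hx, hamVec_secondBivector a hx,
    (hF.hasFDerivAt.log hFx).fderiv]
  simp only [smul_apply, hX, hD, smul_eq_mul, mul_zero, zero_smul, zero_sub]
  rw [← neg_smul, smul_smul]
  have h : 1 / c * -((F x)⁻¹ * (-c * F x)) = 1 := by
    field_simp
  rw [h, one_smul]

theorem hamVec_canonical_eq_laxIntegral {n : ℕ} (a : ℝ) {x : Phase n} (hx : x ∈ domain n) {k : ℕ}
    (hk : 1 ≤ k) (hkx : laxIntegral a k x ≠ 0) :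
    hamVec (canonical n) (hamiltonian a) x
      = (1 / (k : ℝ)) • hamVec (secondBivector n a) (fun y => Real.log (laxIntegral a k y)) x :=
  hamVec_canonical_eq_of_weight a hx (by positivity) (differentiableAt_laxIntegral a hx k) hkx
    (fderiv_laxIntegral_scaledFlow a hx hk) (fderiv_laxIntegral_dilation a hx hk)

end CalogeroMoser

theorem mainTheorem2 (n : ℕ) (a : ℝ) :
    -- `Π`, `Λ` define a natural Poisson bivector `P'`, compatible with the canonical one
    CalogeroMoser.IsNaturalPoissonOn (CalogeroMoser.collisionFree n)
      CalogeroMoser.geodesicMatrix (CalogeroMoser.potentialMatrix a) ∧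
    CalogeroMoser.AreCompatibleOn (CalogeroMoser.domain n)
      (CalogeroMoser.canonical n) (CalogeroMoser.secondBivector n a) ∧
    -- `trace N ^ k = 2 (2 H) ^ k`
    (∀ x ∈ CalogeroMoser.domain n, ∀ k : ℕ, 1 ≤ k →
      (CalogeroMoser.recursionOperator (CalogeroMoser.secondBivector n a) x ^ k).trace
        = 2 * (2 * CalogeroMoser.hamiltonian a x) ^ k) ∧
    -- `H = H_2`
    (∀ x ∈ CalogeroMoser.domain n,
      CalogeroMoser.hamiltonian a x = CalogeroMoser.laxIntegral a 2 x) ∧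
    -- `P dH = (1/2) P' d ln H`
    (∀ x ∈ CalogeroMoser.domain n, CalogeroMoser.hamiltonian a x ≠ 0 →
      CalogeroMoser.hamVec (CalogeroMoser.canonical n) (CalogeroMoser.hamiltonian a) x
        = (1 / 2 : ℝ) • CalogeroMoser.hamVec (CalogeroMoser.secondBivector n a)
            (fun y => Real.log (CalogeroMoser.hamiltonian a y)) x) ∧
    -- the Lax integrals are in bi-involution
    (∀ x ∈ CalogeroMoser.domain n, ∀ k l : ℕ, 1 ≤ k → 1 ≤ l →
      CalogeroMoser.bracket (CalogeroMoser.canonical n)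
          (CalogeroMoser.laxIntegral a k) (CalogeroMoser.laxIntegral a l) x = 0 ∧
      CalogeroMoser.bracket (CalogeroMoser.secondBivector n a)
          (CalogeroMoser.laxIntegral a k) (CalogeroMoser.laxIntegral a l) x = 0) ∧
    -- `P dH = (1/k) P' d ln H_k`
    (∀ x ∈ CalogeroMoser.domain n, ∀ k : ℕ, 1 ≤ k → CalogeroMoser.laxIntegral a k x ≠ 0 →
      CalogeroMoser.hamVec (CalogeroMoser.canonical n) (CalogeroMoser.hamiltonian a) x
        = (1 / (k : ℝ)) • CalogeroMoser.hamVec (CalogeroMoser.secondBivector n a)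
            (fun y => Real.log (CalogeroMoser.laxIntegral a k y)) x) ∧
    -- `P dH = (1/(m-1)) P' d ln K_m`
    (∀ x ∈ CalogeroMoser.domain n, ∀ m : ℕ, 2 ≤ m → CalogeroMoser.extraIntegral a m x ≠ 0 →
      CalogeroMoser.hamVec (CalogeroMoser.canonical n) (CalogeroMoser.hamiltonian a) x
        = (1 / ((m : ℝ) - 1)) • CalogeroMoser.hamVec (CalogeroMoser.secondBivector n a)
            (fun y => Real.log (CalogeroMoser.extraIntegral a m y)) x) := by
  refine ⟨CalogeroMoser.isNaturalPoissonOn_collisionFree n a,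
    CalogeroMoser.areCompatibleOn_domain n a,
    fun x hx k hk => CalogeroMoser.trace_recursionOperator_pow a hx hk,
    fun x _ => CalogeroMoser.hamiltonian_eq_laxIntegral a x, fun x hx h => ?_,
    fun x hx k l hk hl => ⟨CalogeroMoser.bracket_canonical_laxIntegral a hx hk hl,
      CalogeroMoser.bracket_secondBivector_laxIntegral a hx hk hl⟩,
    fun x hx k hk h => CalogeroMoser.hamVec_canonical_eq_laxIntegral a hx hk h,
    fun x hx m hm h => ?_⟩
  · rw [CalogeroMoser.hamiltonian_eq_laxIntegral] at h
    simpa [CalogeroMoser.hamiltonian_eq_laxIntegral]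
      using CalogeroMoser.hamVec_canonical_eq_laxIntegral a hx one_le_two h
  · have hm1 : 1 ≤ m := one_le_two.trans hm
    have hc : (m : ℝ) - 1 ≠ 0 := by
      have h2 : (2 : ℝ) ≤ m := by exact_mod_cast hm
      linarith
    exact CalogeroMoser.hamVec_canonical_eq_of_weight a hx hc
      (CalogeroMoser.differentiableAt_extraIntegral a hx hm1) h
      (CalogeroMoser.fderiv_extraIntegral_scaledFlow a hx hm1)
      (CalogeroMoser.fderiv_extraIntegral_dilation a hx hm1)
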